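/- Let $k, L \ge 1$ be integers and let $a = (a_1,\dots,a_k) \in \mathbb{C}^k$ with $a \neq 0$. Write $\|\cdot\|_2$ for the Euclidean ($\ell_2$) norm on $\mathbb{C}^k$ and on $\mathbb{C}^L$. (i) Let $Z_1,\dots,Z_k$ be independent random vectors, each uniformly distributed on the real unit sphere $S^{L-1} = \{x \in \mathbb{R}^L : \|x\|_2 = 1\}$. Then for every real $u > 1$ $$\mathbb{P}\Big(\Big\|\sum_{j=1}^k a_j Z_j\Big\|_2 \ge u\|a\|_2\Big) \le \exp\Big(-\frac{L}{2}\big(u^2 - \log(u^2) - 1\big)\Big).$$ (ii) Let $Z_1,\dots,Z_k$ be independent random vectors, each uniformly distributed on the complex unit sphere $S^{L-1}_{\mathbb{C}} = \{x \in \mathbb{C}^L : \|x\|_2 = 1\}$. Then for every real $u > 1$ $$\mathbb{P}\Big(\Big\|\sum_{j=1}^k a_j Z_j\Big\|_2 \ge u\|a\|_2\Big) \le \exp\Big(-L\big(u^2 - \log(u^2) - 1\big)\Big).$$ -/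

import Mathlib

open MeasureTheory ProbabilityTheory

/-- The uniform probability distribution on the unit sphere `{x : ‖x‖ = 1}` of a finite-dimensional
real Euclidean space, as a measure on the ambient space: the surface measure that
Lebesgue measure induces on the sphere, normalised to have total mass `1`.
It is used for `ℝ^L` and for `ℂ^L` (regarded as a real Euclidean space of dimension `2 L`). -/
noncomputable def uniformOnSphere (E : Type*) [NormedAddCommGroup E] [InnerProductSpace ℝ E]
    [FiniteDimensional ℝ E] [MeasurableSpace E] [BorelSpace E] : Measure E :=
  (((volume : Measure E).toSphere Set.univ)⁻¹ • (volume : Measure E).toSphere).map Subtype.val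

/-- The inclusion `ℝ^L ⊆ ℂ^L`. -/
noncomputable def realToComplex {L : ℕ} (x : EuclideanSpace ℝ (Fin L)) :
    EuclideanSpace ℂ (Fin L) :=
  WithLp.toLp 2 fun i => (x i : ℂ)

/-!
If `g` is standard Gaussian in `ℝⁿ`, then `z = g / ‖g‖` is uniform on the sphere and independent of
`‖g‖`, while `𝔼 ‖g‖² = n`. Since `s ↦ cosh (√s * y)` is convex, averaging over `s = ‖g‖² / n` shows
that the moment generating function of `⟪v, z⟫` is at most that of `⟪v, g / √n⟫`, namely
`exp (‖v‖² / (2n))`. Hence `⟪v, S⟫` is sub-Gaussian for every independent sum `S = ∑ Aⱼ zⱼ`.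
Substituting `v = √(2s) g'`, with `g'` Gaussian and independent of `S`, and averaging over `g'`
bounds `𝔼 exp (s ‖S‖²)` by the corresponding moment of a scaled chi-squared variable, and Chernoff's
bound gives the tail estimate. Real vectors with complex coefficients have
`‖∑ aⱼ zⱼ‖² = ‖∑ Re aⱼ zⱼ‖² + ‖∑ Im aⱼ zⱼ‖²`; the two terms are dependent, but the exponential
moments of the sum are controlled by convexity of `exp`.
-/

open scoped InnerProductSpace NNReal

lemma hasSum_mul_sinh_div_two (y : ℝ) :
    HasSum (fun m : ℕ => m * (y ^ (2 * m) / (2 * m).factorial)) (y * Real.sinh y / 2) := by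
  rw [← hasSum_nat_add_iff' 1]
  convert! (Real.hasSum_sinh y).mul_left (y / 2) using 1
  · funext m
    have hfact : (2 * (m + 1)).factorial = (2 * m + 2) * (2 * m + 1).factorial :=
      Nat.factorial_succ (2 * m + 1)
    have hne : ((2 * m + 1).factorial : ℝ) ≠ 0 := by positivity
    rw [hfact]
    push_cast
    field_simp
    ring
  · simp only [Finset.range_one, Finset.sum_singleton, CharP.cast_eq_zero, zero_mul, sub_zero]
    ring

/-- The tangent line inequality at `s = 1` for the convex function `s ↦ cosh (√s * y)`. -/
lemma cosh_add_mul_sinh_div_two_mul_le_cosh_mul (y t : ℝ) :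
    Real.cosh y + y * Real.sinh y / 2 * (t ^ 2 - 1) ≤ Real.cosh (t * y) := by
  refine hasSum_le (fun m => ?_)
    ((Real.hasSum_cosh y).add ((hasSum_mul_sinh_div_two y).mul_right (t ^ 2 - 1)))
    (Real.hasSum_cosh (t * y))
  have bernoulli : 1 + m * (t ^ 2 - 1) ≤ (1 + (t ^ 2 - 1)) ^ m :=
    one_add_mul_le_pow (by nlinarith [sq_nonneg t]) m
  have hcoeff : 0 ≤ y ^ (2 * m) / ((2 * m).factorial : ℝ) := by
    rw [pow_mul]
    positivity
  calc y ^ (2 * m) / ((2 * m).factorial : ℝ)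
        + m * (y ^ (2 * m) / (2 * m).factorial) * (t ^ 2 - 1)
      = (1 + m * (t ^ 2 - 1)) * (y ^ (2 * m) / ((2 * m).factorial : ℝ)) := by ring
    _ ≤ (1 + (t ^ 2 - 1)) ^ m * (y ^ (2 * m) / ((2 * m).factorial : ℝ)) := by gcongr
    _ = (t * y) ^ (2 * m) / ((2 * m).factorial : ℝ) := by
      rw [mul_pow, add_sub_cancel, ← pow_mul]
      ring

lemma integral_cosh_eq_integral_exp_of_odd {E : Type*} [AddGroup E] [MeasurableSpace E]
    [MeasurableNeg E] {μ : Measure E} [μ.IsNegInvariant] {f : E → ℝ} (hodd : f.Odd)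
    (hf : Integrable (fun x => Real.exp (f x)) μ) :
    ∫ x, Real.cosh (f x) ∂μ = ∫ x, Real.exp (f x) ∂μ := by
  have hneg : ∫ x, Real.exp (-f x) ∂μ = ∫ x, Real.exp (f x) ∂μ := by
    simp_rw [← hodd _]
    exact integral_neg_eq_self (fun x => Real.exp (f x)) μ
  have hneg_int : Integrable (fun x => Real.exp (-f x)) μ := by
    simp_rw [← hodd _]
    exact hf.comp_neg
  simp_rw [Real.cosh_eq]
  rw [integral_div, integral_add hf hneg_int, hneg]
  ring

section StdGaussian

variable {E : Type*} [NormedAddCommGroup E] [InnerProductSpace ℝ E] [FiniteDimensional ℝ E]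
  [MeasurableSpace E] [BorelSpace E]

instance isNegInvariant_stdGaussian : (stdGaussian E).IsNegInvariant :=
  ⟨stdGaussian_map (LinearIsometryEquiv.neg ℝ)⟩

lemma integrable_exp_neg_sq_norm_div_two :
    Integrable (fun x : E => Real.exp (-‖x‖ ^ 2 / 2)) := by
  refine .of_integral_ne_zero ?_
  have h := GaussianFourier.integral_rexp_neg_mul_sq_norm (V := E) (b := 1 / 2) (by norm_num)
  simp_rw [show ∀ r : ℝ, -(1 / 2) * r ^ 2 = -r ^ 2 / 2 by intro r; ring] at h
  rw [h]
  positivity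

/-- Both measures have characteristic function `exp (-‖t‖² / 2)`. -/
lemma stdGaussian_eq_withDensity :
    stdGaussian E = volume.withDensity fun x : E =>
      ENNReal.ofReal ((2 * Real.pi) ^ (-(Module.finrank ℝ E : ℝ) / 2) *
        Real.exp (-‖x‖ ^ 2 / 2)) := by
  have : IsFiniteMeasure (volume.withDensity fun x : E => ENNReal.ofReal
      ((2 * Real.pi) ^ (-(Module.finrank ℝ E : ℝ) / 2) * Real.exp (-‖x‖ ^ 2 / 2))) :=
    isFiniteMeasure_withDensity_ofReal (integrable_exp_neg_sq_norm_div_two.const_mul _).2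
  refine Measure.ext_of_charFun (funext fun t => ?_)
  have h := GaussianFourier.integral_cexp_neg_mul_sq_norm_add (V := E) (b := 1 / 2) (by norm_num)
    Complex.I t
  rw [charFun_stdGaussian, charFun_apply, integral_withDensity_eq_integral_toReal_smul
    (by fun_prop) (by simp)]
  have integrand (x : E) : (ENNReal.ofReal ((2 * Real.pi) ^ (-(Module.finrank ℝ E : ℝ) / 2) *
      Real.exp (-‖x‖ ^ 2 / 2))).toReal • Complex.exp (⟪x, t⟫_ℝ * Complex.I) =
      ((2 * Real.pi) ^ (-(Module.finrank ℝ E : ℝ) / 2) : ℝ) *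
        Complex.exp (-(1 / 2) * ‖x‖ ^ 2 + Complex.I * ⟪t, x⟫_ℝ) := by
    rw [ENNReal.toReal_ofReal (by positivity), Complex.real_smul, Complex.ofReal_mul, mul_assoc,
      Complex.ofReal_exp, ← Complex.exp_add, real_inner_comm]
    push_cast
    ring_nf
  simp_rw [integrand]
  rw [integral_const_mul, h, show (Real.pi / (1 / 2) : ℂ) = (2 * Real.pi : ℝ) by push_cast; ring,
    show (Module.finrank ℝ E / 2 : ℂ) = (Module.finrank ℝ E / 2 : ℝ) by push_cast; rfl,
    ← Complex.ofReal_cpow (by positivity), ← mul_assoc, ← Complex.ofReal_mul,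
    ← Real.rpow_add (by positivity), ← add_div, neg_add_cancel, zero_div, Real.rpow_zero,
    Complex.I_sq]
  push_cast
  ring_nf

lemma integral_stdGaussian (f : E → ℝ) :
    ∫ x, f x ∂stdGaussian E = (2 * Real.pi) ^ (-(Module.finrank ℝ E : ℝ) / 2) *
      ∫ x, Real.exp (-‖x‖ ^ 2 / 2) * f x := by
  rw [stdGaussian_eq_withDensity, integral_withDensity_eq_integral_toReal_smul
    (by fun_prop) (by simp), ← integral_const_mul]
  refine integral_congr_ae (.of_forall fun x => ?_)
  simp only [smul_eq_mul]
  rw [ENNReal.toReal_ofReal (by positivity), mul_assoc]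

lemma integral_exp_mul_sq_norm_stdGaussian {s : ℝ} (hs : 2 * s < 1) :
    ∫ x : E, Real.exp (s * ‖x‖ ^ 2) ∂stdGaussian E =
      (1 - 2 * s) ^ (-(Module.finrank ℝ E : ℝ) / 2) := by
  have hb : 0 < (1 - 2 * s) / 2 := by linarith
  have hexp (x : E) : Real.exp (-‖x‖ ^ 2 / 2) * Real.exp (s * ‖x‖ ^ 2) =
      Real.exp (-((1 - 2 * s) / 2) * ‖x‖ ^ 2) := by
    rw [← Real.exp_add]
    ring_nf
  rw [integral_stdGaussian]
  simp_rw [hexp]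
  rw [GaussianFourier.integral_rexp_neg_mul_sq_norm hb, neg_div, Real.rpow_neg (by positivity),
    Real.rpow_neg (by linarith), ← Real.inv_rpow (by positivity), ← Real.inv_rpow (by linarith),
    ← Real.mul_rpow (by positivity) (by positivity)]
  congr 1
  field_simp

lemma integrable_exp_mul_sq_norm_stdGaussian {s : ℝ} (hs : 2 * s < 1) :
    Integrable (fun x : E => Real.exp (s * ‖x‖ ^ 2)) (stdGaussian E) := by
  refine .of_integral_ne_zero ?_
  rw [integral_exp_mul_sq_norm_stdGaussian hs]
  exact (Real.rpow_pos_of_pos (by linarith) _).ne'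

lemma map_inner_stdGaussian (v : E) :
    (stdGaussian E).map (fun x => ⟪v, x⟫_ℝ) = gaussianReal 0 (‖v‖₊ ^ 2) := by
  have h := IsGaussian.map_eq_gaussianReal (μ := stdGaussian E) (innerSL ℝ v)
  rw [integral_strongDual_stdGaussian, variance_dual_stdGaussian, innerSL_apply_norm,
    Real.toNNReal_pow (norm_nonneg v), norm_toNNReal] at h
  exact h

lemma integral_exp_inner_stdGaussian (v : E) :
    ∫ x, Real.exp ⟪v, x⟫_ℝ ∂stdGaussian E = Real.exp (‖v‖ ^ 2 / 2) := by
  simpa [mgf] using mgf_gaussianReal (map_inner_stdGaussian v) 1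

lemma integrable_exp_inner_stdGaussian (v : E) :
    Integrable (fun x => Real.exp ⟪v, x⟫_ℝ) (stdGaussian E) := by
  refine .of_integral_ne_zero ?_
  rw [integral_exp_inner_stdGaussian]
  positivity

lemma integrable_cosh_inner_stdGaussian (v : E) :
    Integrable (fun x => Real.cosh ⟪v, x⟫_ℝ) (stdGaussian E) := by
  simp_rw [Real.cosh_eq, ← inner_neg_left]
  exact ((integrable_exp_inner_stdGaussian v).add
    (integrable_exp_inner_stdGaussian (-v))).div_const 2

lemma integral_cosh_inner_stdGaussian (v : E) :
    ∫ x, Real.cosh ⟪v, x⟫_ℝ ∂stdGaussian E = Real.exp (‖v‖ ^ 2 / 2) := by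
  rw [integral_cosh_eq_integral_exp_of_odd (fun x => inner_neg_right v x)
    (integrable_exp_inner_stdGaussian v), integral_exp_inner_stdGaussian]

lemma integrable_sq_norm_stdGaussian : Integrable (fun x : E => ‖x‖ ^ 2) (stdGaussian E) :=
  (IsGaussian.memLp_two_id (μ := stdGaussian E)).integrable_norm_pow two_ne_zero

lemma integral_sq_norm_stdGaussian :
    ∫ x : E, ‖x‖ ^ 2 ∂stdGaussian E = Module.finrank ℝ E := by
  let b := stdOrthonormalBasis ℝ E
  have second_moment (i) : ∫ x, ⟪b i, x⟫_ℝ ^ 2 ∂stdGaussian E = 1 := by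
    have h := variance_dual_stdGaussian (innerSL ℝ (b i))
    rw [variance_of_integral_eq_zero (by fun_prop) (integral_strongDual_stdGaussian _),
      innerSL_apply_norm, b.norm_eq_one, one_pow] at h
    exact h
  have integrable_sq (i) : Integrable (fun x => ⟪b i, x⟫_ℝ ^ 2) (stdGaussian E) :=
    .of_integral_ne_zero (by simp [second_moment])
  simp_rw [← b.sum_sq_inner_right]
  rw [integral_finsetSum _ fun i _ => integrable_sq i]
  simp [second_moment]

end StdGaussian

section UniformOnSphere

variable {E : Type*} [NormedAddCommGroup E] [InnerProductSpace ℝ E] [FiniteDimensional ℝ E]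
  [MeasurableSpace E] [BorelSpace E]

lemma ae_norm_eq_one_uniformOnSphere : ∀ᵐ z ∂uniformOnSphere E, ‖z‖ = 1 := by
  rw [uniformOnSphere, ae_map_iff measurable_subtype_coe.aemeasurable
    (measurableSet_eq_fun measurable_norm measurable_const)]
  exact .of_forall fun z => norm_eq_of_mem_sphere z

lemma integral_uniformOnSphere (f : E → ℝ) :
    ∫ z, f z ∂uniformOnSphere E = ((volume : Measure E).toSphere.real Set.univ)⁻¹ *
      ∫ z, f z ∂(volume : Measure E).toSphere := by
  rw [uniformOnSphere, (MeasurableEmbedding.subtype_coe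
    Metric.isClosed_sphere.measurableSet).integral_map, integral_smul_measure,
    ENNReal.toReal_inv, smul_eq_mul, measureReal_def]

lemma integrable_direction_mul {μ : Measure E} {f : E → ℝ} (hf : Continuous f) {g : E → ℝ}
    (hg : Integrable g μ) : Integrable (fun x => f (‖x‖⁻¹ • x) * g x) μ := by
  obtain ⟨C, hC⟩ := (isCompact_closedBall (0 : E) 1).exists_bound_of_continuousOn hf.continuousOn
  refine hg.bdd_mul (by fun_prop) (.of_forall fun x => hC _ ?_)
  rw [mem_closedBall_zero_iff, norm_smul, norm_inv, norm_norm]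
  exact inv_mul_le_one

variable [Nontrivial E]

instance isProbabilityMeasure_uniformOnSphere : IsProbabilityMeasure (uniformOnSphere E) := by
  have : NeZero (volume : Measure E).toSphere := ⟨Measure.toSphere_ne_zero volume⟩
  exact Measure.isProbabilityMeasure_map measurable_subtype_coe.aemeasurable

lemma integral_direction_mul_norm_eq_toSphere (f : E → ℝ) (g : ℝ → ℝ) :
    ∫ x : E, f (‖x‖⁻¹ • x) * g ‖x‖ =
      (∫ z, f z ∂(volume : Measure E).toSphere) *
        ∫ r, g r ∂Measure.volumeIoiPow (Module.finrank ℝ E - 1) := by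
  calc ∫ x : E, f (‖x‖⁻¹ • x) * g ‖x‖
      = ∫ x : ({(0)}ᶜ : Set E), f (‖x.1‖⁻¹ • x.1) * g ‖x.1‖ ∂(volume.comap Subtype.val) := by
        rw [integral_subtype_comap (measurableSet_singleton _).compl
          fun x : E => f (‖x‖⁻¹ • x) * g ‖x‖, restrict_compl_singleton]
    _ = ∫ p, f p.1 * g p.2
        ∂(volume : Measure E).toSphere.prod (.volumeIoiPow (Module.finrank ℝ E - 1)) := by
        simpa using (volume : Measure E).measurePreserving_homeomorphUnitSphereProd.integral_comp
          (Homeomorph.measurableEmbedding _)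
          (fun p : Metric.sphere (0 : E) 1 × Set.Ioi (0 : ℝ) => f p.1 * g p.2)
    _ = _ := integral_prod_mul (fun z : Metric.sphere (0 : E) 1 => f z)
        (fun r : Set.Ioi (0 : ℝ) => g r)

lemma integral_direction_mul_norm (f : E → ℝ) (g : ℝ → ℝ) :
    ∫ x : E, f (‖x‖⁻¹ • x) * g ‖x‖ = (∫ z, f z ∂uniformOnSphere E) * ∫ x : E, g ‖x‖ := by
  have hmass : (volume : Measure E).toSphere.real Set.univ ≠ 0 :=
    (measureReal_ne_zero_iff).mpr (Measure.measure_univ_ne_zero.mpr (Measure.toSphere_ne_zero _))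
  have radial := integral_direction_mul_norm_eq_toSphere (E := E) (fun _ => 1) g
  simp only [one_mul, integral_const, smul_eq_mul, mul_one] at radial
  rw [radial, integral_uniformOnSphere, integral_direction_mul_norm_eq_toSphere]
  field_simp

lemma integral_direction_mul_norm_stdGaussian (f : E → ℝ) (g : ℝ → ℝ) :
    ∫ x, f (‖x‖⁻¹ • x) * g ‖x‖ ∂stdGaussian E =
      (∫ z, f z ∂uniformOnSphere E) * ∫ x, g ‖x‖ ∂stdGaussian E := by
  simp_rw [integral_stdGaussian, mul_left_comm (Real.exp _)]
  rw [integral_direction_mul_norm f fun r => Real.exp (-r ^ 2 / 2) * g r]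
  ring

lemma integral_comp_direction_stdGaussian (f : E → ℝ) :
    ∫ x, f (‖x‖⁻¹ • x) ∂stdGaussian E = ∫ z, f z ∂uniformOnSphere E := by
  simpa using integral_direction_mul_norm_stdGaussian f fun _ => 1

lemma integral_direction_mul_sq_norm_div_finrank_sub_one_stdGaussian (f : E → ℝ) :
    ∫ x, f (‖x‖⁻¹ • x) * (‖x‖ ^ 2 / Module.finrank ℝ E - 1) ∂stdGaussian E = 0 := by
  have hn : (Module.finrank ℝ E : ℝ) ≠ 0 := Nat.cast_ne_zero.mpr Module.finrank_pos.ne'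
  have mean_eq_zero : ∫ x : E, (‖x‖ ^ 2 / Module.finrank ℝ E - 1) ∂stdGaussian E = 0 := by
    rw [integral_sub (integrable_sq_norm_stdGaussian.div_const _) (integrable_const 1),
      integral_div, integral_sq_norm_stdGaussian, div_self hn]
    simp
  rw [integral_direction_mul_norm_stdGaussian f fun r => r ^ 2 / Module.finrank ℝ E - 1,
    mean_eq_zero, mul_zero]

lemma integral_cosh_inner_uniformOnSphere_le (v : E) :
    ∫ z, Real.cosh ⟪v, z⟫_ℝ ∂uniformOnSphere E ≤
      ∫ x, Real.cosh ⟪(√(Module.finrank ℝ E))⁻¹ • v, x⟫_ℝ ∂stdGaussian E := by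
  set n : ℝ := (Module.finrank ℝ E : ℝ)
  have hn : 0 < n := Nat.cast_pos.mpr Module.finrank_pos
  let slope (z : E) : ℝ := ⟪v, z⟫_ℝ * Real.sinh ⟪v, z⟫_ℝ / 2
  have integrable_cosh : Integrable (fun x : E => Real.cosh ⟪v, ‖x‖⁻¹ • x⟫_ℝ) (stdGaussian E) := by
    simpa using integrable_direction_mul (f := fun z => Real.cosh ⟪v, z⟫_ℝ) (by fun_prop)
      (integrable_const (μ := stdGaussian E) (1 : ℝ))
  have integrable_correction :
      Integrable (fun x => slope (‖x‖⁻¹ • x) * (‖x‖ ^ 2 / n - 1)) (stdGaussian E) :=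
    integrable_direction_mul (by fun_prop)
      ((integrable_sq_norm_stdGaussian.div_const n).sub (integrable_const 1))
  have tangent_le (x : E) : Real.cosh ⟪v, ‖x‖⁻¹ • x⟫_ℝ + slope (‖x‖⁻¹ • x) * (‖x‖ ^ 2 / n - 1) ≤
      Real.cosh ⟪(√n)⁻¹ • v, x⟫_ℝ := by
    have h := cosh_add_mul_sinh_div_two_mul_le_cosh_mul ⟪v, ‖x‖⁻¹ • x⟫_ℝ (‖x‖ / √n)
    have hx : ‖x‖ / √n * ⟪v, ‖x‖⁻¹ • x⟫_ℝ = ⟪(√n)⁻¹ • v, x⟫_ℝ := by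
      rcases eq_or_ne x 0 with rfl | hx
      · simp
      · rw [real_inner_smul_left, real_inner_smul_right]
        have := norm_ne_zero_iff.mpr hx
        field_simp
    rwa [hx, div_pow, Real.sq_sqrt hn.le] at h
  calc ∫ z, Real.cosh ⟪v, z⟫_ℝ ∂uniformOnSphere E
      = ∫ x, (Real.cosh ⟪v, ‖x‖⁻¹ • x⟫_ℝ + slope (‖x‖⁻¹ • x) * (‖x‖ ^ 2 / n - 1))
          ∂stdGaussian E := by
        rw [integral_add integrable_cosh integrable_correction,
          integral_direction_mul_sq_norm_div_finrank_sub_one_stdGaussian, add_zero,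
          integral_comp_direction_stdGaussian fun z => Real.cosh ⟪v, z⟫_ℝ]
    _ ≤ ∫ x, Real.cosh ⟪(√n)⁻¹ • v, x⟫_ℝ ∂stdGaussian E :=
        integral_mono (integrable_cosh.add integrable_correction)
          (integrable_cosh_inner_stdGaussian _) tangent_le

lemma integral_exp_inner_uniformOnSphere_le (v : E) :
    ∫ z, Real.exp ⟪v, z⟫_ℝ ∂uniformOnSphere E ≤
      Real.exp (‖v‖ ^ 2 / Module.finrank ℝ E / 2) := by
  have odd_direction : (fun x : E => ⟪v, ‖x‖⁻¹ • x⟫_ℝ).Odd := fun x => by simp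
  have integrable_exp : Integrable (fun x : E => Real.exp ⟪v, ‖x‖⁻¹ • x⟫_ℝ) (stdGaussian E) := by
    simpa using integrable_direction_mul (f := fun z => Real.exp ⟪v, z⟫_ℝ) (by fun_prop)
      (integrable_const (μ := stdGaussian E) (1 : ℝ))
  calc ∫ z, Real.exp ⟪v, z⟫_ℝ ∂uniformOnSphere E
      = ∫ z, Real.cosh ⟪v, z⟫_ℝ ∂uniformOnSphere E := by
        rw [← integral_comp_direction_stdGaussian fun z => Real.exp ⟪v, z⟫_ℝ,
          ← integral_cosh_eq_integral_exp_of_odd odd_direction integrable_exp,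
          integral_comp_direction_stdGaussian fun z => Real.cosh ⟪v, z⟫_ℝ]
    _ ≤ ∫ x, Real.cosh ⟪(√(Module.finrank ℝ E))⁻¹ • v, x⟫_ℝ ∂stdGaussian E :=
        integral_cosh_inner_uniformOnSphere_le v
    _ = Real.exp (‖(√(Module.finrank ℝ E))⁻¹ • v‖ ^ 2 / 2) := by
        rw [integral_cosh_inner_stdGaussian]
    _ = Real.exp (‖v‖ ^ 2 / Module.finrank ℝ E / 2) := by
        rw [norm_smul, mul_pow, norm_inv, inv_pow, Real.norm_of_nonneg (Real.sqrt_nonneg _),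
          Real.sq_sqrt (Nat.cast_nonneg _), inv_mul_eq_div]

lemma hasSubgaussianMGF_inner_uniformOnSphere (v : E) :
    HasSubgaussianMGF (fun z => ⟪v, z⟫_ℝ) (‖v‖₊ ^ 2 / Module.finrank ℝ E) (uniformOnSphere E) where
  integrable_exp_mul t := by
    refine .of_bound (by fun_prop) (Real.exp (|t| * ‖v‖)) ?_
    filter_upwards [ae_norm_eq_one_uniformOnSphere] with z hz
    rw [Real.norm_of_nonneg (Real.exp_pos _).le, Real.exp_le_exp]
    have hinner : |⟪v, z⟫_ℝ| ≤ ‖v‖ := by simpa [hz] using abs_real_inner_le_norm v z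
    calc t * ⟪v, z⟫_ℝ ≤ |t| * |⟪v, z⟫_ℝ| := abs_mul t _ ▸ le_abs_self _
      _ ≤ |t| * ‖v‖ := by gcongr
  mgf_le t := by
    have h := integral_exp_inner_uniformOnSphere_le (t • v)
    simp only [real_inner_smul_left] at h
    refine h.trans_eq ?_
    rw [norm_smul, mul_pow, Real.norm_eq_abs, sq_abs]
    push_cast
    ring_nf

end UniformOnSphere

/-- The random variable `X` has exponential moments at most those of `σ` times a chi-squared
variable with `d` degrees of freedom, at every parameter `s ≥ 0` where the latter are finite. -/
structure HasSubChiSqMGF {Ω : Type*} [MeasurableSpace Ω] (X : Ω → ℝ) (d σ : ℝ) (P : Measure Ω) :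
    Prop where
  integrable_exp_mul : ∀ s, 0 ≤ s → 2 * s * σ < 1 → Integrable (fun ω => Real.exp (s * X ω)) P
  mgf_le : ∀ s, 0 ≤ s → 2 * s * σ < 1 → mgf X P s ≤ (1 - 2 * s * σ) ^ (-d / 2)

namespace HasSubChiSqMGF

variable {Ω : Type*} [MeasurableSpace Ω] {P : Measure Ω} {X Y : Ω → ℝ} {d σ σ₁ σ₂ : ℝ}

lemma measure_ge_le [IsFiniteMeasure P] (hX : HasSubChiSqMGF X d σ P) (hσ : 0 < σ) {r : ℝ}
    (hr : 1 ≤ r) :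
    P.real {ω | r * (d * σ) ≤ X ω} ≤ Real.exp (-(d / 2) * (r - Real.log r - 1)) := by
  have hr0 : 0 < r := one_pos.trans_le hr
  -- This `s` minimises the Chernoff bound `exp (-s r d σ) * (1 - 2 s σ) ^ (-d / 2)`.
  obtain ⟨s, hs⟩ : ∃ s, s = (1 - r⁻¹) / (2 * σ) := ⟨_, rfl⟩
  have hs0 : 0 ≤ s := by
    rw [hs]
    exact div_nonneg (sub_nonneg.mpr (inv_le_one_of_one_le₀ hr)) (by positivity)
  have hsσ : 1 - 2 * s * σ = r⁻¹ := by
    rw [hs]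
    field_simp
    ring
  have hs1 : 2 * s * σ < 1 := by linarith [inv_pos.mpr hr0]
  calc P.real {ω | r * (d * σ) ≤ X ω}
      ≤ Real.exp (-s * (r * (d * σ))) * mgf X P s :=
        measure_ge_le_exp_mul_mgf _ hs0 (hX.integrable_exp_mul s hs0 hs1)
    _ ≤ Real.exp (-s * (r * (d * σ))) * (1 - 2 * s * σ) ^ (-d / 2) := by
        gcongr
        exact hX.mgf_le s hs0 hs1
    _ = Real.exp (-(d / 2) * (r - Real.log r - 1)) := by
        rw [hsσ, Real.rpow_def_of_pos (inv_pos.mpr hr0), Real.log_inv, ← Real.exp_add, hs]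
        congr 1
        field_simp
        ring

lemma measure_norm_ge_le [IsFiniteMeasure P] {F : Type*} [NormedAddCommGroup F] {S : Ω → F}
    {τ u : ℝ} (hS : HasSubChiSqMGF (fun ω => ‖S ω‖ ^ 2) d (τ ^ 2 / d) P) (hd : 0 < d) (hτ : 0 < τ)
    (hu : 1 ≤ u) :
    P.real {ω | u * τ ≤ ‖S ω‖} ≤ Real.exp (-(d / 2) * (u ^ 2 - Real.log (u ^ 2) - 1)) := by
  have hset : {ω | u * τ ≤ ‖S ω‖} = {ω | u ^ 2 * (d * (τ ^ 2 / d)) ≤ ‖S ω‖ ^ 2} := by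
    ext ω
    rw [Set.mem_ofPred_eq, Set.mem_ofPred_eq, mul_div_cancel₀ _ hd.ne', ← mul_pow,
      pow_le_pow_iff_left₀ (by positivity) (norm_nonneg _) two_ne_zero]
  rw [hset]
  exact hS.measure_ge_le (by positivity) (one_le_pow₀ hu)

lemma const_mul (hX : HasSubChiSqMGF X d σ P) {c : ℝ} (hc : 0 ≤ c) :
    HasSubChiSqMGF (fun ω => c * X ω) d (c * σ) P where
  integrable_exp_mul s hs hsσ := by
    simpa only [mul_assoc] using hX.integrable_exp_mul (s * c) (by positivity) (by linarith)
  mgf_le s hs hsσ := by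
    have h := hX.mgf_le (s * c) (by positivity) (by linarith)
    rwa [mgf_const_mul, mul_comm c s, ← mul_assoc, mul_assoc 2]

lemma convex_combination (hX : HasSubChiSqMGF X d σ P) (hY : HasSubChiSqMGF Y d σ P) {p q : ℝ}
    (hp : 0 ≤ p) (hq : 0 ≤ q) (hpq : p + q = 1) :
    HasSubChiSqMGF (fun ω => p * X ω + q * Y ω) d σ P := by
  have exp_le (s : ℝ) (ω : Ω) : Real.exp (s * (p * X ω + q * Y ω)) ≤
      p * Real.exp (s * X ω) + q * Real.exp (s * Y ω) := by
    calc Real.exp (s * (p * X ω + q * Y ω))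
        = Real.exp (p • (s * X ω) + q • (s * Y ω)) := by
          rw [smul_eq_mul, smul_eq_mul]
          ring_nf
      _ ≤ p • Real.exp (s * X ω) + q • Real.exp (s * Y ω) :=
          convexOn_exp.2 (Set.mem_univ _) (Set.mem_univ _) hp hq hpq
  have exp_eq (s : ℝ) (ω : Ω) : Real.exp (s * (p * X ω + q * Y ω)) =
      Real.exp (s * X ω) ^ p * Real.exp (s * Y ω) ^ q := by
    rw [← Real.exp_mul, ← Real.exp_mul, ← Real.exp_add]
    ring_nf
  have integrable_exp (s : ℝ) (hs : 0 ≤ s) (hsσ : 2 * s * σ < 1) :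
      Integrable (fun ω => Real.exp (s * (p * X ω + q * Y ω))) P := by
    have hXs := hX.integrable_exp_mul s hs hsσ
    have hYs := hY.integrable_exp_mul s hs hsσ
    refine ((hXs.const_mul p).add (hYs.const_mul q)).mono' ?_ (.of_forall fun ω => ?_)
    · simp_rw [exp_eq]
      exact ((hXs.aemeasurable.pow_const p).mul
        (hYs.aemeasurable.pow_const q)).aestronglyMeasurable
    · rw [Real.norm_of_nonneg (Real.exp_pos _).le]
      exact exp_le s ω
  refine ⟨integrable_exp, fun s hs hsσ => ?_⟩
  have hXs := (hX.integrable_exp_mul s hs hsσ).const_mul p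
  have hYs := (hY.integrable_exp_mul s hs hsσ).const_mul q
  calc mgf (fun ω => p * X ω + q * Y ω) P s
      ≤ ∫ ω, (p * Real.exp (s * X ω) + q * Real.exp (s * Y ω)) ∂P :=
        integral_mono (integrable_exp s hs hsσ) (hXs.add hYs) (exp_le s)
    _ = p * mgf X P s + q * mgf Y P s := by
        rw [integral_add hXs hYs, integral_const_mul, integral_const_mul, mgf, mgf]
    _ ≤ p * (1 - 2 * s * σ) ^ (-d / 2) + q * (1 - 2 * s * σ) ^ (-d / 2) := by
        gcongr
        · exact hX.mgf_le s hs hsσ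
        · exact hY.mgf_le s hs hsσ
    _ = (1 - 2 * s * σ) ^ (-d / 2) := by rw [← add_mul, hpq, one_mul]

lemma add (hX : HasSubChiSqMGF X d σ₁ P) (hY : HasSubChiSqMGF Y d σ₂ P) (hσ₁ : 0 < σ₁)
    (hσ₂ : 0 < σ₂) : HasSubChiSqMGF (fun ω => X ω + Y ω) d (σ₁ + σ₂) P := by
  have hX' := hX.const_mul (c := (σ₁ + σ₂) / σ₁) (by positivity)
  have hY' := hY.const_mul (c := (σ₁ + σ₂) / σ₂) (by positivity)
  rw [div_mul_cancel₀ _ hσ₁.ne'] at hX'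
  rw [div_mul_cancel₀ _ hσ₂.ne'] at hY'
  convert! hX'.convex_combination hY' (p := σ₁ / (σ₁ + σ₂)) (q := σ₂ / (σ₁ + σ₂))
    (by positivity) (by positivity) (by field_simp) using 3
  all_goals field_simp

end HasSubChiSqMGF

section GaussianDecoupling

variable {Ω : Type*} [MeasurableSpace Ω] {P : Measure Ω}
  {E : Type*} [NormedAddCommGroup E] [InnerProductSpace ℝ E] {S : Ω → E} {σ : ℝ≥0}

lemma integral_exp_inner_sqrt_smul_le
    (hsub : ∀ v : E, HasSubgaussianMGF (fun ω => ⟪v, S ω⟫_ℝ) (σ * ‖v‖₊ ^ 2) P) {s : ℝ} (hs : 0 ≤ s)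
    (g : E) : ∫ ω, Real.exp ⟪√(2 * s) • g, S ω⟫_ℝ ∂P ≤ Real.exp (s * σ * ‖g‖ ^ 2) := by
  have h := (hsub (√(2 * s) • g)).mgf_le 1
  simp only [mgf, one_mul] at h
  refine h.trans_eq ?_
  push_cast
  rw [norm_smul, mul_pow, Real.norm_of_nonneg (Real.sqrt_nonneg _), Real.sq_sqrt (by positivity)]
  ring_nf

variable [FiniteDimensional ℝ E] [MeasurableSpace E] [BorelSpace E]

lemma integral_exp_inner_sqrt_smul_stdGaussian {s : ℝ} (hs : 0 ≤ s) (x : E) :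
    ∫ g, Real.exp ⟪√(2 * s) • g, x⟫_ℝ ∂stdGaussian E = Real.exp (s * ‖x‖ ^ 2) := by
  have inner_eq (g : E) : ⟪√(2 * s) • g, x⟫_ℝ = ⟪√(2 * s) • x, g⟫_ℝ := by
    rw [real_inner_smul_left, real_inner_smul_left, real_inner_comm]
  simp_rw [inner_eq]
  rw [integral_exp_inner_stdGaussian, norm_smul, mul_pow, Real.norm_of_nonneg (Real.sqrt_nonneg _),
    Real.sq_sqrt (by positivity)]
  ring_nf

lemma integrable_exp_inner_sqrt_smul_prod_stdGaussian [SFinite P] (hS : AEMeasurable S P)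
    (hsub : ∀ v : E, HasSubgaussianMGF (fun ω => ⟪v, S ω⟫_ℝ) (σ * ‖v‖₊ ^ 2) P) {s : ℝ} (hs : 0 ≤ s)
    (hsσ : 2 * s * σ < 1) :
    Integrable (fun p : Ω × E => Real.exp ⟪√(2 * s) • p.2, S p.1⟫_ℝ) (P.prod (stdGaussian E)) := by
  have hS_fst : AEMeasurable (fun p : Ω × E => S p.1) (P.prod (stdGaussian E)) := hS.comp_fst
  have hmeas : AEStronglyMeasurable (fun p : Ω × E => Real.exp ⟪√(2 * s) • p.2, S p.1⟫_ℝ)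
      (P.prod (stdGaussian E)) :=
    ((measurable_snd.const_smul _).aemeasurable.inner hS_fst).exp.aestronglyMeasurable
  refine (integrable_prod_iff' hmeas).mpr ⟨.of_forall fun g => ?_, ?_⟩
  · simpa using (hsub (√(2 * s) • g)).integrable_exp_mul 1
  · refine (integrable_exp_mul_sq_norm_stdGaussian (s := s * σ) (by linarith)).mono'
      hmeas.norm.prod_swap.integral_prod_right' (.of_forall fun g => ?_)
    simp only [Real.norm_eq_abs, Real.abs_exp]
    rw [abs_of_nonneg (integral_nonneg fun ω => (Real.exp_pos _).le)]
    exact integral_exp_inner_sqrt_smul_le hsub hs g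

/-- Averaging the bound for `exp ⟪v, S⟫` over `v = √(2s) g` with `g` standard Gaussian turns it
into a bound for `exp (s ‖S‖²)`. -/
lemma hasSubChiSqMGF_sq_norm_of_hasSubgaussianMGF_inner [SFinite P] (hS : AEMeasurable S P)
    (hsub : ∀ v : E, HasSubgaussianMGF (fun ω => ⟪v, S ω⟫_ℝ) (σ * ‖v‖₊ ^ 2) P) :
    HasSubChiSqMGF (fun ω => ‖S ω‖ ^ 2) (Module.finrank ℝ E) σ P where
  integrable_exp_mul s hs hsσ := by
    simpa only [integral_exp_inner_sqrt_smul_stdGaussian hs] using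
      (integrable_exp_inner_sqrt_smul_prod_stdGaussian hS hsub hs hsσ).integral_prod_left
  mgf_le s hs hsσ := by
    have hint := integrable_exp_inner_sqrt_smul_prod_stdGaussian hS hsub hs hsσ
    calc mgf (fun ω => ‖S ω‖ ^ 2) P s
        = ∫ ω, ∫ g, Real.exp ⟪√(2 * s) • g, S ω⟫_ℝ ∂stdGaussian E ∂P := by
          simp_rw [integral_exp_inner_sqrt_smul_stdGaussian hs]
          rfl
      _ = ∫ g, ∫ ω, Real.exp ⟪√(2 * s) • g, S ω⟫_ℝ ∂P ∂stdGaussian E :=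
          integral_integral_swap hint
      _ ≤ ∫ g, Real.exp (s * σ * ‖g‖ ^ 2) ∂stdGaussian E :=
          integral_mono hint.integral_prod_right
            (integrable_exp_mul_sq_norm_stdGaussian (by linarith))
            (integral_exp_inner_sqrt_smul_le hsub hs)
      _ = (1 - 2 * s * σ) ^ (-(Module.finrank ℝ E : ℝ) / 2) := by
          rw [integral_exp_mul_sq_norm_stdGaussian (by linarith), mul_assoc]

end GaussianDecoupling

section IndependentSums

lemma hasSubgaussianMGF_of_le {Ω : Type*} [MeasurableSpace Ω] {P : Measure Ω} {X : Ω → ℝ}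
    {c c' : ℝ≥0} (hX : HasSubgaussianMGF X c P) (hc : c ≤ c') : HasSubgaussianMGF X c' P where
  integrable_exp_mul := hX.integrable_exp_mul
  mgf_le t := (hX.mgf_le t).trans (by gcongr)

variable {Ω : Type*} [MeasurableSpace Ω] {P : Measure Ω} {ι : Type*} [Fintype ι]
  {E : Type*} [NormedAddCommGroup E] [InnerProductSpace ℝ E] [FiniteDimensional ℝ E]
  [MeasurableSpace E] [BorelSpace E] [Nontrivial E] {Z : ι → Ω → E}

lemma hasSubgaussianMGF_inner_sum_uniformOnSphere {F : Type*} [NormedAddCommGroup F]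
    [InnerProductSpace ℝ F] [CompleteSpace F]
    (hZ : ∀ j, HasLaw (Z j) (uniformOnSphere E) P) (hind : iIndepFun Z P) (A : ι → E →L[ℝ] F)
    (v : F) :
    HasSubgaussianMGF (fun ω => ⟪v, ∑ j, A j (Z j ω)⟫_ℝ)
      ((∑ j, ‖A j‖₊ ^ 2) / Module.finrank ℝ E * ‖v‖₊ ^ 2) P := by
  have hterm (j : ι) : HasSubgaussianMGF (fun ω => ⟪(A j).adjoint v, Z j ω⟫_ℝ)
      (‖A j‖₊ ^ 2 / Module.finrank ℝ E * ‖v‖₊ ^ 2) P := by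
    refine hasSubgaussianMGF_of_le (.of_map (hZ j).aemeasurable ((hZ j).map_eq ▸
      hasSubgaussianMGF_inner_uniformOnSphere ((A j).adjoint v))) ?_
    have hadjoint : ‖(A j).adjoint v‖₊ ≤ ‖A j‖₊ * ‖v‖₊ := by
      simpa using (A j).adjoint.le_opNNNorm v
    rw [div_mul_eq_mul_div, ← mul_pow]
    gcongr
  have hind_inner : iIndepFun (fun j ω => ⟪(A j).adjoint v, Z j ω⟫_ℝ) P :=
    hind.comp (fun j z => ⟪(A j).adjoint v, z⟫_ℝ) fun j => by fun_prop
  have hsum := HasSubgaussianMGF.sum_of_iIndepFun hind_inner (s := Finset.univ)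
    fun j _ => hterm j
  simpa only [inner_sum, ContinuousLinearMap.adjoint_inner_left, ← Finset.sum_mul,
    ← Finset.sum_div] using hsum

lemma hasSubChiSqMGF_sq_norm_sum_uniformOnSphere {F : Type*} [NormedAddCommGroup F]
    [InnerProductSpace ℝ F] [FiniteDimensional ℝ F]
    (hZ : ∀ j, HasLaw (Z j) (uniformOnSphere E) P) (hind : iIndepFun Z P) (A : ι → E →L[ℝ] F) :
    HasSubChiSqMGF (fun ω => ‖∑ j, A j (Z j ω)‖ ^ 2) (Module.finrank ℝ F)
      ((∑ j, ‖A j‖ ^ 2) / Module.finrank ℝ E) P := by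
  borelize F
  have := hind.isProbabilityMeasure
  have hmeas : AEMeasurable (fun ω => ∑ j, A j (Z j ω)) P :=
    Finset.aemeasurable_fun_sum _ fun j _ => (A j).measurable.comp_aemeasurable (hZ j).aemeasurable
  simpa using hasSubChiSqMGF_sq_norm_of_hasSubgaussianMGF_inner hmeas
    (hasSubgaussianMGF_inner_sum_uniformOnSphere hZ hind A)

lemma hasSubChiSqMGF_sq_norm_sum_smul_uniformOnSphere {𝕜 : Type*} [NormedField 𝕜]
    [NormedAlgebra ℝ 𝕜] [NormedSpace 𝕜 E]
    (hZ : ∀ j, HasLaw (Z j) (uniformOnSphere E) P) (hind : iIndepFun Z P) (a : ι → 𝕜) :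
    HasSubChiSqMGF (fun ω => ‖∑ j, a j • Z j ω‖ ^ 2) (Module.finrank ℝ E)
      ((∑ j, ‖a j‖ ^ 2) / Module.finrank ℝ E) P := by
  simpa [norm_smul] using hasSubChiSqMGF_sq_norm_sum_uniformOnSphere hZ hind
    fun j => a j • ContinuousLinearMap.id ℝ E

lemma hasSubChiSqMGF_sq_norm_sum_smul_add_uniformOnSphere
    (hZ : ∀ j, HasLaw (Z j) (uniformOnSphere E) P) (hind : iIndepFun Z P) (b c : ι → ℝ) :
    HasSubChiSqMGF (fun ω => ‖∑ j, b j • Z j ω‖ ^ 2 + ‖∑ j, c j • Z j ω‖ ^ 2)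
      (Module.finrank ℝ E) ((∑ j, b j ^ 2 + ∑ j, c j ^ 2) / Module.finrank ℝ E) P := by
  have hn : (0 : ℝ) < Module.finrank ℝ E := Nat.cast_pos.mpr Module.finrank_pos
  have hB := hasSubChiSqMGF_sq_norm_sum_smul_uniformOnSphere hZ hind b
  have hC := hasSubChiSqMGF_sq_norm_sum_smul_uniformOnSphere hZ hind c
  simp only [Real.norm_eq_abs, sq_abs] at hB hC
  have eq_zero_of_sum_sq {b : ι → ℝ} (hb : 0 = ∑ j, b j ^ 2) (j : ι) : b j = 0 :=
    pow_eq_zero_iff two_ne_zero |>.mp <|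
      (Finset.sum_eq_zero_iff_of_nonneg fun j _ => sq_nonneg (b j)).mp hb.symm j (Finset.mem_univ j)
  rcases (Finset.univ.sum_nonneg fun j _ => sq_nonneg (b j)).eq_or_lt with hb | hb
  · simpa [eq_zero_of_sum_sq hb] using hC
  rcases (Finset.univ.sum_nonneg fun j _ => sq_nonneg (c j)).eq_or_lt with hc | hc
  · simpa [eq_zero_of_sum_sq hc] using hB
  rw [add_div]
  exact hB.add hC (by positivity) (by positivity)

end IndependentSums

lemma sq_norm_sum_smul_realToComplex {ι : Type*} [Fintype ι] {L : ℕ} (a : ι → ℂ)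
    (x : ι → EuclideanSpace ℝ (Fin L)) :
    ‖∑ j, a j • realToComplex (x j)‖ ^ 2 =
      ‖∑ j, (a j).re • x j‖ ^ 2 + ‖∑ j, (a j).im • x j‖ ^ 2 := by
  simp only [EuclideanSpace.norm_sq_eq, ← Finset.sum_add_distrib]
  refine Finset.sum_congr rfl fun i _ => ?_
  simp [realToComplex, Complex.sq_norm, Complex.normSq_apply, ← sq]

lemma sq_norm_eq_sum_sq_re_add_sum_sq_im {ι : Type*} [Fintype ι]
    (a : EuclideanSpace ℂ ι) : ‖a‖ ^ 2 = ∑ j, (a j).re ^ 2 + ∑ j, (a j).im ^ 2 := by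
  simp only [EuclideanSpace.norm_sq_eq, ← Finset.sum_add_distrib, Complex.sq_norm,
    Complex.normSq_apply, ← sq]

theorem mainTheorem3 {Ω : Type*} [MeasurableSpace Ω] (P : Measure Ω) [IsProbabilityMeasure P]
    (k L : ℕ) (hL : 1 ≤ L) (a : EuclideanSpace ℂ (Fin k)) (ha : a ≠ 0) :
    (∀ Z : Fin k → Ω → EuclideanSpace ℝ (Fin L),
      (∀ j, HasLaw (Z j) (uniformOnSphere (EuclideanSpace ℝ (Fin L))) P) →
      iIndepFun Z P →
      ∀ u : ℝ, 1 < u →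
        P.real {ω | u * ‖a‖ ≤ ‖∑ j, a j • realToComplex (Z j ω)‖} ≤
          Real.exp (-((L : ℝ) / 2) * (u ^ 2 - Real.log (u ^ 2) - 1))) ∧
    (∀ Z : Fin k → Ω → EuclideanSpace ℂ (Fin L),
      (∀ j, HasLaw (Z j) (uniformOnSphere (EuclideanSpace ℂ (Fin L))) P) →
      iIndepFun Z P →
      ∀ u : ℝ, 1 < u →
        P.real {ω | u * ‖a‖ ≤ ‖∑ j, a j • Z j ω‖} ≤
          Real.exp (-(L : ℝ) * (u ^ 2 - Real.log (u ^ 2) - 1))) := by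
  have : Nonempty (Fin L) := ⟨⟨0, hL⟩⟩
  have hL0 : (0 : ℝ) < L := by exact_mod_cast hL
  have ha0 : 0 < ‖a‖ := norm_pos_iff.mpr ha
  refine ⟨fun Z hZ hind u hu => ?_, fun Z hZ hind u hu => ?_⟩
  · have hS := hasSubChiSqMGF_sq_norm_sum_smul_add_uniformOnSphere hZ hind
      (fun j => (a j).re) (fun j => (a j).im)
    simp_rw [← sq_norm_sum_smul_realToComplex] at hS
    rw [← sq_norm_eq_sum_sq_re_add_sum_sq_im, finrank_euclideanSpace_fin] at hS
    exact hS.measure_norm_ge_le hL0 ha0 hu.le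
  · have hS := hasSubChiSqMGF_sq_norm_sum_smul_uniformOnSphere hZ hind a
    rw [← EuclideanSpace.norm_sq_eq, finrank_real_of_complex, finrank_euclideanSpace_fin] at hS
    have h := hS.measure_norm_ge_le (by positivity) ha0 hu.le
    rwa [Nat.cast_mul, Nat.cast_two, mul_div_cancel_left₀ _ two_ne_zero] at h
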